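/- For integers $n\ge 0$, $r\ge 0$, $t\ge 1$ let $H_n^{(t)}=\sum_{j=1}^n \frac{1}{j^t}$ and $$S_n(\{2\}^r)=\sum_{1\le j_1\le j_2\le\cdots\le j_r\le n}\frac{1}{j_1^2 j_2^2\cdots j_r^2},\qquad S_n(\{2\}^0)=1,$$ and let $B_n$ denote the $n$-th Bernoulli number. Let $r\ge 0$ be an integer and let $p$ be a prime with $p>2r+3$. Then $$\sum_{k=1}^{p-1}\frac{\binom{2k}{k}^2}{k\,16^k}\,S_k(\{2\}^r)\equiv -2H^{(2r+1)}_{(p-1)/2}-\frac{r\,(2^{2r+3}-1)}{2}\,p^2B_{p-2r-3}\pmod{p^3}.$$ Here both sides are rational numbers whose denominators are not divisible by $p$, and $a\equiv b\pmod{p^3}$ means that $a-b$ equals $p^3$ times a rational number whose denominator is not divisible by $p$. -/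

import Mathlib

/-- The harmonic number of order `t`: `H_n^{(t)} = ∑_{j=1}^{n} 1 / j ^ t`. -/
def harmonicOfOrder (t n : ℕ) : ℚ :=
  ∑ j ∈ Finset.Icc 1 n, 1 / (j : ℚ) ^ t

/-- The non-strict multiple harmonic sum
`S_n(t_1, …, t_r) = ∑_{1 ≤ j_1 ≤ ⋯ ≤ j_r ≤ n} 1 / (j_1 ^ t_1 ⋯ j_r ^ t_r)`.
The index tuples are the weakly increasing functions from `Fin r` to `{1, …, n}`;
for `r = 0` the empty tuple is the only one and the sum is `1`. -/
def multipleHarmonicSum (n : ℕ) {r : ℕ} (t : Fin r → ℕ) : ℚ :=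
  ∑ j ∈ (Fintype.piFinset fun _ : Fin r => Finset.Icc 1 n) with ∀ a b, a ≤ b → j a ≤ j b,
    1 / ∏ i, (j i : ℚ) ^ t i

/-- A rational number is `p`-integral (for `p` prime: lies in `ℤ_p`) if `p` does not divide
its reduced denominator. -/
def IsPIntegral (p : ℕ) (a : ℚ) : Prop := ¬ p ∣ a.den

/-- Congruence `a ≡ b (mod p ^ m)` between `p`-integral rational numbers: both sides are
`p`-integral and their difference is `p ^ m` times a `p`-integral rational number. -/
def PIntegralModEq (p m : ℕ) (a b : ℚ) : Prop :=
  IsPIntegral p a ∧ IsPIntegral p b ∧ ∃ c : ℚ, IsPIntegral p c ∧ a - b = (p : ℚ) ^ m * c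

/-! Let `h(y) = ∑_{k<p} (1/k) S_k({2}^r) ∏_{j≤k} (y + (j-1)j)/j²`, which is `pronicSum`. The left
side of the congruence is `h(1/4)`. Put `y = x - x²`. Then `y + (j-1)j = (j-1+x)(j-x)`, so `h(x-x²)
- h(-x-x²)` collapses to `2x` times `squareSum`, which equals `m^(-2r-2)` at `x = m` with `1 ≤ m <
p`. Since `h(0) = 0`, telescoping gives exactly `h(-n-n²) = -2 H_n^{(2r+1)}` for `n ≤ p-1`
(`pronicSum_neg_pronic`). For `n = (p-1)/2` the argument `-n-n²` is `1/4 - p²/4`, so by Taylor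
expansion only `h'(1/4)` mod `p` is missing. Modulo `p`, `squareSum` is an explicit polynomial, and
`f(x) = h(x-x²)` solves a difference equation with a particular solution built from Bernoulli
polynomials. Any other solution of degree below `2p` differs by some `a + b(x^p - x)`, which two
derivatives kill. As `f''(1/2) = -2h'(1/4)`, this expresses `h'(1/4)` through a Bernoulli polynomial
at `1/2` (`ZMod.eval_derivative_pronicSum`). The sequence `v` stands for `k ↦ 1/k`, so that the same
identities serve over ℚ, over the `p`-integral rationals and over polynomial rings. -/

open Finset

/-! ### Product and sum identities over an arbitrary commutative ring. -/

section Generic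

variable {A B : Type*} [CommRing A] [CommRing B]

/-- The sums `∑_{1 ≤ j_1 ≤ ⋯ ≤ j_r ≤ n} v (j_1) ^ 2 ⋯ v (j_r) ^ 2`. -/
def iteratedSum (v : ℕ → A) : ℕ → ℕ → A
  | 0, _ => 1
  | r + 1, n => ∑ j ∈ range n, v (j + 1) ^ 2 * iteratedSum v r (j + 1)

/-- The product `∏_{1 ≤ j ≤ n} v (j) ^ 2 (j ^ 2 - x ^ 2)`. -/
def squareProd (v : ℕ → A) (x : A) (n : ℕ) : A :=
  ∏ j ∈ range n, v (j + 1) ^ 2 * (((j + 1 : ℕ) : A) ^ 2 - x ^ 2)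

/-- The product `∏_{1 ≤ j ≤ n} v (j) ^ 2 (y + (j - 1) j)`. -/
def pronicProd (v : ℕ → A) (y : A) (n : ℕ) : A :=
  ∏ j ∈ range n, v (j + 1) ^ 2 * (y + ((j : ℕ) : A) * ((j + 1 : ℕ) : A))

/-- The sum `∑_{1 ≤ k ≤ n} v (k) ^ 2 S_k V_{k - 1}`, where `S` is `iteratedSum` and `V` is
`squareProd`. -/
def squareSum (v : ℕ → A) (r : ℕ) (x : A) (n : ℕ) : A :=
  ∑ k ∈ range n, v (k + 1) ^ 2 * squareProd v x k * iteratedSum v r (k + 1)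

/-- The sum `∑_{1 ≤ k ≤ n} v (k) S_k P_k`, where `S` is `iteratedSum` and `P` is `pronicProd`. -/
def pronicSum (v : ℕ → A) (r : ℕ) (y : A) (n : ℕ) : A :=
  ∑ k ∈ range n, v (k + 1) * iteratedSum v r (k + 1) * pronicProd v y (k + 1)

theorem map_iteratedSum (φ : A →+* B) (v : ℕ → A) (r n : ℕ) :
    φ (iteratedSum v r n) = iteratedSum (fun k => φ (v k)) r n := by
  induction r generalizing n with
  | zero => simp [iteratedSum]
  | succ r ih => simp [iteratedSum, ih]

theorem map_pronicSum (φ : A →+* B) (v : ℕ → A) (r n : ℕ) (y : A) :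
    φ (pronicSum v r y n) = pronicSum (fun k => φ (v k)) r (φ y) n := by
  simp [pronicSum, pronicProd, map_iteratedSum]

theorem iteratedSum_succ_succ (v : ℕ → A) (r n : ℕ) :
    iteratedSum v (r + 1) (n + 1)
      = iteratedSum v (r + 1) n + v (n + 1) ^ 2 * iteratedSum v r (n + 1) := by
  simp [iteratedSum, sum_range_succ]

theorem iteratedSum_congr {v w : ℕ → A} {n : ℕ} (h : ∀ k, 1 ≤ k → k ≤ n → v k = w k) (r : ℕ) :
    iteratedSum v r n = iteratedSum w r n := by
  induction r generalizing n with
  | zero => rfl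
  | succ r ih =>
    refine sum_congr rfl fun j hj => ?_
    have hj := mem_range.1 hj
    rw [h _ (by omega) (by omega), ih fun k h1 h2 => h k h1 (by omega)]

theorem squareProd_succ (v : ℕ → A) (x : A) (n : ℕ) :
    squareProd v x (n + 1)
      = squareProd v x n * (v (n + 1) ^ 2 * (((n + 1 : ℕ) : A) ^ 2 - x ^ 2)) :=
  prod_range_succ _ _

theorem squareProd_natCast (v : ℕ → A) {m n : ℕ} (hm : 1 ≤ m) (hmn : m ≤ n) :
    squareProd v (m : A) n = 0 := by
  refine prod_eq_zero (i := m - 1) (mem_range.2 (by omega)) ?_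
  rw [Nat.sub_add_cancel hm]
  ring

/-- Telescoping: the `k`-th factor of `squareProd` is `1 - x²/k²`, so `x² V_{k-1}/k² = V_{k-1} -
V_k`. -/
theorem sq_mul_squareSum_zero {v : ℕ → A} {n : ℕ} (hv : ∀ k, 1 ≤ k → k ≤ n → k * v k = 1)
    (x : A) : x ^ 2 * squareSum v 0 x n = 1 - squareProd v x n := by
  induction n with
  | zero => simp [squareSum, squareProd]
  | succ n ih =>
    have h1 := ih fun k h1 h2 => hv k h1 (by omega)
    have h2 := hv (n + 1) (by omega) le_rfl
    rw [squareSum, sum_range_succ, mul_add, ← squareSum, h1, squareProd_succ]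
    simp only [iteratedSum]
    linear_combination (squareProd v x n * (((n + 1 : ℕ) : A) * v (n + 1) + 1)) * h2

/-- Summation by parts on the same telescoping, which lowers the depth `r` by one. -/
theorem sq_mul_squareSum_succ {v : ℕ → A} {n : ℕ} (hv : ∀ k, 1 ≤ k → k ≤ n → k * v k = 1)
    (r : ℕ) (x : A) : x ^ 2 * squareSum v (r + 1) x n
      = squareSum v r x n - squareProd v x n * iteratedSum v (r + 1) n := by
  induction n with
  | zero => simp [squareSum, iteratedSum]
  | succ n ih =>
    have h1 := ih fun k h1 h2 => hv k h1 (by omega)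
    have h2 := hv (n + 1) (by omega) le_rfl
    have e (s : ℕ) : squareSum v s x (n + 1) = squareSum v s x n
        + v (n + 1) ^ 2 * squareProd v x n * iteratedSum v s (n + 1) := sum_range_succ _ _
    rw [e, e, mul_add, h1, squareProd_succ, iteratedSum_succ_succ]
    linear_combination (squareProd v x n * (iteratedSum v (r + 1) n
      + v (n + 1) ^ 2 * iteratedSum v r (n + 1)) * (((n + 1 : ℕ) : A) * v (n + 1) + 1)) * h2

/-- Each factor splits as `(x+j)(j+1-x)`. Regrouping the linear factors pairs `j+x` with `j-x` and
leaves the two end factors `x` and `n+1-x`. -/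
theorem pronicProd_succ_eq {v : ℕ → A} (x : A) {n : ℕ}
    (hv : ∀ k, 1 ≤ k → k ≤ n + 1 → k * v k = 1) :
    pronicProd v (x - x ^ 2) (n + 1)
      = v (n + 1) ^ 2 * (x * (((n + 1 : ℕ) : A) - x)) * squareProd v x n := by
  induction n with
  | zero => simp [pronicProd, squareProd]; ring
  | succ n ih =>
    have h1 := ih fun k h1 h2 => hv k h1 (by omega)
    rw [pronicProd, prod_range_succ, ← pronicProd, h1, squareProd_succ]
    push_cast
    ring

theorem pronicSum_sub_pronicSum {v : ℕ → A} {n : ℕ} (hv : ∀ k, 1 ≤ k → k ≤ n → k * v k = 1)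
    (r : ℕ) (x : A) :
    pronicSum v r (x - x ^ 2) n - pronicSum v r (-x - x ^ 2) n = 2 * x * squareSum v r x n := by
  have hx : -x - x ^ 2 = -x - (-x) ^ 2 := by ring
  rw [pronicSum, pronicSum, squareSum, ← sum_sub_distrib, mul_sum]
  refine sum_congr rfl fun k hk => ?_
  have hk := mem_range.1 hk
  have h := hv (k + 1) (by omega) (by omega)
  have hs : squareProd v (-x) k = squareProd v x k := by simp [squareProd]
  rw [hx, pronicProd_succ_eq x fun j h1 h2 => hv j h1 (by omega),
    pronicProd_succ_eq (-x) fun j h1 h2 => hv j h1 (by omega), hs]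
  linear_combination (2 * x * v (k + 1) ^ 2 * squareProd v x k * iteratedSum v r (k + 1)) * h

theorem natCast_pow_mul_squareSum {v : ℕ → A} {n : ℕ}
    (hv : ∀ k, 1 ≤ k → k ≤ n → k * v k = 1) {m : ℕ} (hm : 1 ≤ m) (hmn : m ≤ n) (r : ℕ) :
    (m : A) ^ (2 * r + 2) * squareSum v r (m : A) n = 1 := by
  induction r with
  | zero => simpa [squareProd_natCast v hm hmn] using sq_mul_squareSum_zero hv (m : A)
  | succ r ih =>
    have h := sq_mul_squareSum_succ hv r (m : A)
    rw [squareProd_natCast v hm hmn, zero_mul, sub_zero] at h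
    rw [← ih, ← h]
    ring

theorem pronicSum_neg_pronic {v : ℕ → A} {n : ℕ} (hv : ∀ k, 1 ≤ k → k ≤ n → k * v k = 1)
    (r : ℕ) {m : ℕ} (hmn : m ≤ n) :
    pronicSum v r (-m - (m : A) ^ 2) n = -2 * ∑ j ∈ range m, v (j + 1) ^ (2 * r + 1) := by
  induction m with
  | zero =>
    simp only [pronicSum, range_zero, sum_empty, mul_zero]
    refine sum_eq_zero fun k _ => ?_
    rw [pronicProd, prod_eq_zero (i := 0) (by simp) (by simp), mul_zero]
  | succ m ih =>
    have h1 := pronicSum_sub_pronicSum hv r ((m + 1 : ℕ) : A)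
    have h2 := natCast_pow_mul_squareSum hv (m := m + 1) (by omega) hmn r
    have h3 := hv (m + 1) (by omega) hmn
    have e : ((m + 1 : ℕ) : A) - ((m + 1 : ℕ) : A) ^ 2 = -m - (m : A) ^ 2 := by push_cast; ring
    have h4 : ((m + 1 : ℕ) : A) * squareSum v r ((m + 1 : ℕ) : A) n = v (m + 1) ^ (2 * r + 1) := by
      have h5 : (((m + 1 : ℕ) : A) * v (m + 1)) ^ (2 * r + 1) = 1 := by rw [h3, one_pow]
      rw [mul_pow] at h5
      calc _ = (((m + 1 : ℕ) : A) ^ (2 * r + 1) * v (m + 1) ^ (2 * r + 1))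
              * (((m + 1 : ℕ) : A) * squareSum v r ((m + 1 : ℕ) : A) n) := by rw [h5, one_mul]
        _ = v (m + 1) ^ (2 * r + 1)
              * (((m + 1 : ℕ) : A) ^ (2 * r + 2) * squareSum v r ((m + 1 : ℕ) : A) n) := by ring
        _ = _ := by rw [h2, mul_one]
    rw [e, ih (by omega)] at h1
    rw [sum_range_succ]
    linear_combination -h1 - 2 * h4

end Generic

/-! ### The difference equation modulo `p`. -/

section PrimeField

open Polynomial

variable {p : ℕ} [Fact p.Prime]

theorem ZMod.prod_range_X_sub_C :
    ∏ j ∈ range (p - 1), (X - C (((j + 1 : ℕ) : ZMod p))) = X ^ (p - 1) - 1 := by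
  have hp := (Fact.out : p.Prime)
  have h1 : ∏ a : ZMod p, (X - C a) = X ^ p - X := by
    have hm : (X ^ p - X : (ZMod p)[X]).Monic := monic_X_pow_sub (by
      rw [degree_X]; exact_mod_cast hp.one_lt)
    have hr : (X ^ p - X : (ZMod p)[X]).roots = Finset.univ.val := by
      simpa using FiniteField.roots_X_pow_card_sub_X (ZMod p)
    have h := prod_multiset_X_sub_C_of_monic_of_roots_card_eq hm (by
      rw [hr, FiniteField.X_pow_card_sub_X_natDegree_eq _ hp.one_lt]; simp)
    rw [hr] at h
    exact h
  have h2 : ∏ a : ZMod p, (X - C a) = ∏ j ∈ range p, (X - C ((j : ℕ) : ZMod p)) :=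
    prod_nbij' ZMod.val Nat.cast (fun a _ => mem_range.2 a.val_lt) (fun _ _ => mem_univ _)
      (fun a _ => ZMod.natCast_zmod_val a)
      (fun j hj => ZMod.val_cast_of_lt (mem_range.1 hj))
      (fun a _ => by rw [ZMod.natCast_zmod_val])
  have h3 : p = p - 1 + 1 := (Nat.sub_add_cancel hp.one_le).symm
  have h4 : X * ∏ j ∈ range (p - 1), (X - C (((j + 1 : ℕ) : ZMod p)))
      = X * (X ^ (p - 1) - 1) := by
    calc _ = ∏ j ∈ range (p - 1 + 1), (X - C ((j : ℕ) : ZMod p)) := by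
          rw [prod_range_succ']; simp [mul_comm]
      _ = X ^ p - X := by rw [← h3, ← h2, h1]
      _ = _ := by rw [mul_sub, mul_one, ← pow_succ', ← h3]
  exact mul_left_cancel₀ X_ne_zero h4

/-- Both `∏ (X-j)` and `∏ (-X-j)` equal `X^(p-1) - 1`, as `p-1` is even; Wilson's theorem makes the
product of the inverses `-1`. -/
theorem ZMod.squareProd_X (hp2 : p ≠ 2) {v : ℕ → ZMod p}
    (hv : ∀ k, 1 ≤ k → k ≤ p - 1 → k * v k = 1) :
    squareProd (fun k => C (v k)) X (p - 1) = (X ^ (p - 1) - 1) ^ 2 := by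
  have hp := (Fact.out : p.Prime)
  have he : Even (p - 1) := hp.even_sub_one hp2
  have h1 := ZMod.prod_range_X_sub_C (p := p)
  have h2 := congrArg (fun f => f.comp (-X)) h1
  simp only [Polynomial.prod_comp, sub_comp, X_comp, C_comp, pow_comp, one_comp, he.neg_pow] at h2
  have h3 : ∏ j ∈ range (p - 1), (((j + 1 : ℕ) : ZMod p)) = -1 := by
    rw [← ZMod.wilsons_lemma p, ← prod_range_add_one_eq_factorial]
    push_cast
    rfl
  have h4 : (∏ j ∈ range (p - 1), (((j + 1 : ℕ) : ZMod p))) * ∏ j ∈ range (p - 1), v (j + 1)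
      = 1 := by
    rw [← prod_mul_distrib]
    exact prod_eq_one fun j hj => hv _ (by omega) (by have := mem_range.1 hj; omega)
  have h5 : ∏ j ∈ range (p - 1), v (j + 1) = -1 := by
    rw [h3] at h4
    linear_combination -h4
  calc squareProd (fun k => C (v k)) X (p - 1)
      = ∏ j ∈ range (p - 1), C (v (j + 1)) ^ 2 * ((X - C (((j + 1 : ℕ) : ZMod p)))
          * (-X - C (((j + 1 : ℕ) : ZMod p)))) := by
        refine prod_congr rfl fun j _ => ?_
        rw [C_eq_natCast]
        ring
    _ = (C (∏ j ∈ range (p - 1), v (j + 1))) ^ 2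
          * ((X ^ (p - 1) - 1) * (X ^ (p - 1) - 1)) := by
        rw [prod_mul_distrib, prod_mul_distrib, h1, h2, prod_pow, map_prod]
    _ = _ := by rw [h5]; simp; ring

theorem ZMod.squareSum_X {v : ℕ → ZMod p} (hv : ∀ k, 1 ≤ k → k ≤ p - 1 → k * v k = 1) {r : ℕ}
    (hpr : 2 * r + 3 < p) :
    squareSum (fun k => C (v k)) r X (p - 1) = X ^ (p - 3 - 2 * r) * (2 - X ^ (p - 1)) := by
  have hv' : ∀ k, 1 ≤ k → k ≤ p - 1 → (k : (ZMod p)[X]) * C (v k) = 1 := fun k h1 h2 => by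
    rw [← C_eq_natCast, ← C_mul, hv k h1 h2, C_1]
  have hV := ZMod.squareProd_X (by omega) hv
  refine mul_left_cancel₀ (pow_ne_zero 2 X_ne_zero) ?_
  induction r with
  | zero =>
    rw [sq_mul_squareSum_zero hv', hV, ← mul_assoc, ← pow_add,
      show 2 + (p - 3 - 2 * 0) = p - 1 by omega]
    ring
  | succ r ih =>
    have h1 := mul_left_cancel₀ (pow_ne_zero 2 X_ne_zero) (ih (by omega))
    have h2 := sq_mul_squareSum_succ hv' r X
    rw [h1, hV, ← map_iteratedSum] at h2
    -- The constant term shows that `S_{p-1}({2}^{r+1})` vanishes mod `p`.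
    have h3 := congrArg (eval 0) h2
    have h4 : p - 1 ≠ 0 := by omega
    have h5 : p - 3 - 2 * r ≠ 0 := by omega
    simp [h4, h5] at h3
    rw [h2, h3, map_zero, mul_zero, sub_zero, ← mul_assoc, ← pow_add]
    congr 2
    omega

theorem ZMod.eq_C_of_comp_X_add_one_eq {f : (ZMod p)[X]} (hf : f.comp (X + 1) = f)
    (hd : f.natDegree < p) : f = C (f.eval 0) := by
  rw [← sub_eq_zero]
  refine eq_zero_of_natDegree_lt_card_of_eval_eq_zero _ (f := id) Function.injective_id
    (fun a => ?_) (by simpa using hd)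
  have h : ∀ n : ℕ, f.eval (n : ZMod p) = f.eval 0 := fun n => by
    induction n with
    | zero => simp
    | succ n ih => rw [← ih]; conv_rhs => rw [← hf]
                   simp
  simpa [sub_eq_zero] using h a.val

/-- Division by the translation-invariant `X^p - X` has translation-invariant quotient and
remainder. Both have degree below `p`, hence are constants, and `X^p - X` has derivative `-1`. -/
theorem ZMod.derivative_derivative_eq_zero {f : (ZMod p)[X]} (hf : f.comp (X + 1) = f)
    (hd : f.natDegree < 2 * p) : derivative (derivative f) = 0 := by
  have hp := (Fact.out : p.Prime)
  set g : (ZMod p)[X] := X ^ p - X with hg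
  have hm : g.Monic := monic_X_pow_sub (by rw [degree_X]; exact_mod_cast hp.one_lt)
  have hgn : g.natDegree = p := FiniteField.X_pow_card_sub_X_natDegree_eq _ hp.one_lt
  have hgc : g.comp (X + 1) = g := by
    simp [hg, add_pow_char]
  have h1 := modByMonic_add_div f g
  have h2 := congrArg (fun q => q.comp (X + 1)) h1
  simp only [add_comp, mul_comp, hgc, hf] at h2
  have hdeg : (f %ₘ g).natDegree < p := by
    have := natDegree_modByMonic_lt f hm (by intro h; rw [h] at hgn; simp at hgn; exact hp.ne_zero hgn.symm)
    omega
  have hlin : (X + 1 : (ZMod p)[X]) = X + C 1 := by simp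
  have huniq := div_modByMonic_unique (f := f) ((f /ₘ g).comp (X + 1)) ((f %ₘ g).comp (X + 1)) hm
    ⟨h2, by
      apply degree_lt_degree
      rw [natDegree_comp, hlin, natDegree_X_add_C, mul_one, hgn]; exact hdeg⟩
  have h3 := ZMod.eq_C_of_comp_X_add_one_eq huniq.2.symm hdeg
  have h4 := ZMod.eq_C_of_comp_X_add_one_eq huniq.1.symm (by
    rw [natDegree_divByMonic f hm, hgn]; omega)
  have hXp : derivative (X ^ p : (ZMod p)[X]) = 0 := by rw [derivative_X_pow]; simp
  rw [← h1, h3, h4]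
  simp [hg, hXp]

theorem natDegree_pronicSum_le (v : ℕ → ZMod p) (r n : ℕ) :
    (pronicSum (fun k => C (v k)) r X n).natDegree ≤ n := by
  refine natDegree_sum_le_of_forall_le _ _ fun k hk => ?_
  rw [← map_iteratedSum, ← C_mul]
  refine (natDegree_C_mul_le _ _).trans ?_
  have h := mem_range.1 hk
  refine (natDegree_prod_le _ _).trans
    ((sum_le_sum (g := fun _ => 1) fun j _ => ?_).trans (by simpa using h))
  rw [← C_pow, ← C_eq_natCast, ← C_eq_natCast, ← C_mul]
  exact (natDegree_C_mul_le _ _).trans (natDegree_X_add_C _).le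

theorem ZMod.eval_derivative_pronicSum {v : ℕ → ZMod p}
    (hv : ∀ k, 1 ≤ k → k ≤ p - 1 → k * v k = 1) {r : ℕ} (hpr : 2 * r + 3 < p) {s t : (ZMod p)[X]}
    (hs : s.comp (X + 1) = s + X ^ (p - 2 - 2 * r))
    (ht : t.comp (X + 1) = t + X ^ (p - 3 - 2 * r))
    (hsd : s.natDegree < p) (htd : t.natDegree < p)
    (hst : derivative s = ((p - 2 - 2 * r : ℕ) : (ZMod p)[X]) * t) {c : ZMod p} (hc : 2 * c = 1) :
    (derivative (pronicSum (fun k => C (v k)) r X (p - 1))).eval (c ^ 2)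
      = -2 * r * (derivative t).eval c := by
  have hp := (Fact.out : p.Prime)
  have hv' : ∀ k, 1 ≤ k → k ≤ p - 1 → (k : (ZMod p)[X]) * C (v k) = 1 := fun k h1 h2 => by
    rw [← C_eq_natCast, ← C_mul, hv k h1 h2, C_1]
  set h : (ZMod p)[X] := pronicSum (fun k => C (v k)) r X (p - 1) with hh
  have hcomp : ∀ q : (ZMod p)[X], h.comp q = pronicSum (fun k => C (v k)) r q (p - 1) := fun q => by
    have := map_pronicSum (compRingHom q) (fun k => C (v k)) r (p - 1) X
    simpa using this
  set f := h.comp (X - X ^ 2) with hf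
  have hf1 : f.comp (X + 1) = f - 2 * X * (X ^ (p - 3 - 2 * r) * (2 - X ^ (p - 1))) := by
    have e := pronicSum_sub_pronicSum hv' r X
    rw [ZMod.squareSum_X hv hpr, ← hcomp, ← hcomp, ← hf] at e
    rw [← e, hf, comp_assoc]
    have : (X - X ^ 2 : (ZMod p)[X]).comp (X + 1) = -X - X ^ 2 := by simp; ring
    rw [this]
    ring
  -- The subtracted term is a particular solution: `X^p - X` is invariant under the shift, so it
  -- acts as a constant on the difference of `t`.
  set g := f - (-2 * s + 2 * (X ^ p - X) * t) with hg
  have hgc : g.comp (X + 1) = g := by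
    have e1 : (X ^ (p - 2 - 2 * r) : (ZMod p)[X]) = X * X ^ (p - 3 - 2 * r) := by
      rw [← pow_succ']; congr 1; omega
    have e2 : (X ^ p : (ZMod p)[X]) = X * X ^ (p - 1) := by
      rw [← pow_succ']; congr 1; omega
    have e3 : (X ^ p - X : (ZMod p)[X]).comp (X + 1) = X ^ p - X := by simp [add_pow_char]
    have e4 : g.comp (X + 1) = f.comp (X + 1)
        - (-2 * s.comp (X + 1) + 2 * ((X ^ p - X : (ZMod p)[X]).comp (X + 1)) * t.comp (X + 1)) := by
      simp [hg]
    rw [e4, e3, hf1, hs, ht, e1, hg, e2]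
    ring
  have hgd : g.natDegree < 2 * p := by
    have d1 : f.natDegree ≤ (p - 1) * 2 := by
      refine natDegree_comp_le.trans (Nat.mul_le_mul (natDegree_pronicSum_le v r _) ?_)
      compute_degree
    have d2 : (-2 * s + 2 * (X ^ p - X) * t : (ZMod p)[X]).natDegree < 2 * p := by
      have d3 : (-2 * s).natDegree < 2 * p := by
        have := natDegree_C_mul_le (-2 : ZMod p) s
        simp only [map_neg, map_ofNat] at this
        omega
      have d4 : (2 * (X ^ p - X) * t).natDegree < 2 * p := by
        have e1 := natDegree_C_mul_le (2 : ZMod p) ((X ^ p - X) * t)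
        have e2 := natDegree_mul_le (p := (X ^ p - X : (ZMod p)[X])) (q := t)
        rw [FiniteField.X_pow_card_sub_X_natDegree_eq _ hp.one_lt] at e2
        simp only [map_ofNat, ← mul_assoc] at e1
        omega
      exact (natDegree_add_le _ _).trans_lt (max_lt d3 d4)
    exact (natDegree_sub_le _ _).trans_lt (max_lt (by omega) d2)
  have key := ZMod.derivative_derivative_eq_zero hgc hgd
  have h2 : (2 : ZMod p) ≠ 0 := fun h => by simp [h] at hc
  have hcp : c ^ p = c := ZMod.pow_card c
  have e1 : c - c ^ 2 = c ^ 2 := by linear_combination (-c) * hc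
  have hm : ((p - 2 - 2 * r : ℕ) : ZMod p) = -2 - 2 * r := by
    have : p - 2 - 2 * r + (2 + 2 * r) = p := by omega
    have := congrArg (Nat.cast (R := ZMod p)) this
    push_cast at this
    rw [CharP.cast_eq_zero (ZMod p) p] at this
    linear_combination this
  have hXp : derivative (X ^ p : (ZMod p)[X]) = 0 := by rw [derivative_X_pow]; simp
  -- At `c = 1/2` the factor `1 - 2x` kills the `h''` term, and `c^p = c` kills the `t''` term.
  have key2 := congrArg (eval c) key
  simp [hg, hf, derivative_comp, hst, hcp, e1, hm, hXp] at key2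
  refine mul_left_cancel₀ h2 ?_
  linear_combination (2 * c - 1) * (derivative (derivative h)).eval (c ^ 2) * hc - key2

end PrimeField

/-! ### The `p`-integral rationals and their reduction modulo `p`. -/

section PIntegral

/-- The subring of `p`-integral rational numbers. -/
def pIntegralSubring (p : ℕ) [Fact p.Prime] : Subring ℚ where
  carrier := {q | IsPIntegral p q}
  one_mem' := by simpa [IsPIntegral] using (Fact.out : p.Prime).one_lt.ne'
  zero_mem' := by simpa [IsPIntegral] using (Fact.out : p.Prime).one_lt.ne'
  neg_mem' := by simp [IsPIntegral]
  add_mem' {a b} ha hb h := by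
    rcases (Fact.out : p.Prime).dvd_mul.1 (h.trans (Rat.add_den_dvd a b)) with h | h
    exacts [ha h, hb h]
  mul_mem' {a b} ha hb h := by
    rcases (Fact.out : p.Prime).dvd_mul.1 (h.trans (Rat.mul_den_dvd a b)) with h | h
    exacts [ha h, hb h]

variable {p : ℕ} [Fact p.Prime]

theorem IsPIntegral.den_ne_zero {q : ℚ} (h : IsPIntegral p q) : (q.den : ZMod p) ≠ 0 :=
  fun h' => h ((ZMod.natCast_eq_zero_iff _ _).1 h')

/-- The reduction modulo `p` of `p`-integral rational numbers. -/
def pIntegralReduction (p : ℕ) [Fact p.Prime] : pIntegralSubring p →+* ZMod p where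
  toFun q := ((q : ℚ) : ZMod p)
  map_one' := by simp
  map_zero' := by simp
  map_add' a b := Rat.cast_add_of_ne_zero (IsPIntegral.den_ne_zero a.2) (IsPIntegral.den_ne_zero b.2)
  map_mul' a b := Rat.cast_mul_of_ne_zero (IsPIntegral.den_ne_zero a.2) (IsPIntegral.den_ne_zero b.2)

theorem inv_natCast_mem_pIntegralSubring {k : ℕ} (hk : ¬ p ∣ k) :
    (1 / k : ℚ) ∈ pIntegralSubring p := by
  intro h
  refine hk (h.trans ?_)
  have := Rat.den_dvd 1 k
  exact Int.natCast_dvd_natCast.1 (by simpa only [Rat.divInt_eq_div, Int.cast_one, Int.cast_natCast] using this)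

theorem exists_eq_mul_of_pIntegralReduction_eq_zero {q : pIntegralSubring p}
    (hq : pIntegralReduction p q = 0) : ∃ c : pIntegralSubring p, q = p * c := by
  have h1 : (((q : ℚ).num : ZMod p)) / (((q : ℚ).den : ℕ) : ZMod p) = 0 := by
    rw [← Rat.cast_def]; exact hq
  have h2 : (((q : ℚ).num : ZMod p)) = 0 := by
    rcases div_eq_zero_iff.1 h1 with h | h
    exacts [h, absurd h (IsPIntegral.den_ne_zero q.2)]
  obtain ⟨d, hd⟩ := (ZMod.intCast_zmod_eq_zero_iff_dvd _ p).1 h2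
  refine ⟨(d : pIntegralSubring p) * ⟨_, inv_natCast_mem_pIntegralSubring q.2⟩, ?_⟩
  ext
  push_cast
  conv_lhs => rw [← Rat.num_div_den (q : ℚ), hd]
  push_cast
  ring

/-- The recurrence divides only by integers up to `n+1 < p`. -/
theorem bernoulli_mem_pIntegralSubring {n : ℕ} (hn : n + 1 < p) :
    bernoulli n ∈ pIntegralSubring p := by
  suffices h : bernoulli' n ∈ pIntegralSubring p from
    mul_mem (pow_mem (neg_mem (one_mem _)) _) h
  induction n using Nat.strong_induction_on with
  | _ n ih =>
    rw [bernoulli'_def']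
    refine sub_mem (one_mem _) (sum_mem fun k _ => ?_)
    have hk := k.2
    have e : ((n.choose k : ℚ)) / (n - k + 1) * bernoulli' k
        = n.choose k * (1 / ((n - k + 1 : ℕ) : ℚ)) * bernoulli' k := by
      push_cast [Nat.cast_sub hk.le]
      ring
    rw [e]
    refine mul_mem (mul_mem (natCast_mem _ _) (inv_natCast_mem_pIntegralSubring fun h => ?_))
      (ih k hk (by omega))
    have := Nat.le_of_dvd (by omega) h
    omega

end PIntegral

/-! ### Bernoulli polynomials at `1/2`. -/

namespace Polynomial

theorem eq_C_of_comp_X_add_one_eq {f : ℚ[X]} (hf : f.comp (X + 1) = f) : f = C (f.eval 0) := by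
  have h : ∀ n : ℕ, f.eval (n : ℚ) = f.eval 0 := fun n => by
    induction n with
    | zero => simp
    | succ n ih =>
      rw [← ih]
      conv_rhs => rw [← hf]
      simp
  refine eq_of_infinite_eval_eq _ _ (Set.infinite_of_injective_forall_mem Nat.cast_injective
    fun n => ?_)
  simpa using h n

theorem bernoulli_comp_X_add_one (n : ℕ) :
    (bernoulli n).comp (X + 1) = bernoulli n + n • X ^ (n - 1) := by
  rw [add_comm X, bernoulli_comp_one_add_X]

/-- The duplication formula for Bernoulli polynomials. -/
theorem bernoulli_duplication (n : ℕ) :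
    C (2 ^ n) * ((bernoulli n).comp (C (1 / 2) * X) + (bernoulli n).comp (C (1 / 2) * (X + 1)))
      = 2 * bernoulli n := by
  -- The defect `T (n+1)` is 1-periodic, hence constant; its derivative `(n+1) T n` is therefore
  -- zero.
  set T : ℕ → ℚ[X] := fun n => C (2 ^ n) * ((bernoulli n).comp (C (1 / 2) * X)
    + (bernoulli n).comp (C (1 / 2) * (X + 1))) - 2 * bernoulli n with hT
  have h1 : ∀ n, (T (n + 1)).comp (X + 1) = T (n + 1) := fun n => by
    have e : (bernoulli (n + 1)).comp (C (1 / 2) * (X + 1 + 1))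
        = (bernoulli (n + 1)).comp (C (1 / 2) * X)
          + C ((n + 1 : ℚ) * (1 / 2) ^ n) * X ^ n := by
      have e1 : (C (1 / 2) * (X + 1 + 1) : ℚ[X]) = (X + 1).comp (C (1 / 2) * X) := by
        have : (C (1 / 2) * (1 + 1) : ℚ[X]) = 1 := by
          rw [one_add_one_eq_two, ← C_ofNat, ← C_mul]; norm_num
        simp only [add_comp, X_comp, one_comp]
        linear_combination this
      rw [e1, ← comp_assoc, bernoulli_comp_X_add_one, C_mul, C_pow]
      simp only [nsmul_eq_mul, add_comp, mul_comp, natCast_comp, pow_comp, X_comp, mul_pow,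
        Nat.add_sub_cancel, C_add, C_1, map_natCast]
      push_cast
      ring
    have e2 : (C (2 ^ (n + 1)) * C ((n + 1 : ℚ) * (1 / 2) ^ n) : ℚ[X]) = 2 * (n + 1) := by
      rw [← C_mul, show (2 ^ (n + 1) * ((n + 1 : ℚ) * (1 / 2) ^ n)) = 2 * (n + 1) by
        rw [pow_succ, one_div, inv_pow]; field_simp]
      simp only [C_mul, C_add, C_1, map_natCast, map_ofNat]
    simp only [hT, sub_comp, mul_comp, add_comp, comp_assoc, C_comp, X_comp, one_comp,
      ofNat_comp, e, bernoulli_comp_X_add_one, nsmul_eq_mul, Nat.add_sub_cancel]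
    push_cast
    linear_combination X ^ n * e2
  have h2 : ∀ n, derivative (T (n + 1)) = (n + 1) * T n := fun n => by
    have e2 : (C (2 ^ (n + 1)) * C (1 / 2) : ℚ[X]) = C (2 ^ n) := by
      rw [← C_mul, pow_succ]; congr 1; ring
    simp only [hT, derivative_sub, derivative_mul, derivative_add, derivative_comp, derivative_C,
      derivative_X, derivative_one, derivative_ofNat, derivative_bernoulli_add_one]
    simp only [mul_comp, add_comp, natCast_comp, one_comp]
    linear_combination (n + 1 : ℚ[X]) * ((bernoulli n).comp (C (1 / 2) * X)
      + (bernoulli n).comp (C (1 / 2) * (X + 1))) * e2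
  have h3 := h2 n
  rw [eq_C_of_comp_X_add_one_eq (h1 n), derivative_C] at h3
  have h4 : ((n : ℚ[X]) + 1) ≠ 0 := by exact_mod_cast n.succ_ne_zero
  exact sub_eq_zero.1 ((mul_eq_zero.1 h3.symm).resolve_left h4)

theorem two_pow_mul_bernoulli_eval_half (n : ℕ) :
    2 ^ n * (bernoulli n).eval (1 / 2) = (2 - 2 ^ n) * _root_.bernoulli n := by
  have h := congrArg (eval 0) (bernoulli_duplication n)
  simp only [eval_mul, eval_add, eval_comp, eval_C, eval_X, eval_one, eval_ofNat, mul_zero,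
    zero_add, mul_one, bernoulli_eval_zero] at h
  linear_combination h

theorem exists_map_subtype_eq {R : Subring ℚ} {f : ℚ[X]} (hf : ∀ i, f.coeff i ∈ R) :
    ∃ g : R[X], g.map R.subtype = f := by
  have : f ∈ lifts R.subtype := (lifts_iff_coeff_lifts f).2 fun i => by simpa using hf i
  simpa [mem_lifts] using this

end Polynomial

/-! ### Identifying the left side with the value at `1/4`. -/

theorem sum_Icc_one_eq_sum_range {M : Type*} [AddCommMonoid M] (f : ℕ → M) (n : ℕ) :
    ∑ k ∈ Icc 1 n, f k = ∑ k ∈ range n, f (k + 1) := by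
  induction n with
  | zero => simp
  | succ n ih => rw [sum_Icc_succ_top (by omega), ih, sum_range_succ]

/-- Split off the largest index, the last entry of the tuple. -/
theorem multipleHarmonicSum_two_succ (r n : ℕ) :
    multipleHarmonicSum n (fun _ : Fin (r + 1) => 2)
      = ∑ m ∈ Icc 1 n, (1 / (m : ℚ)) ^ 2 * multipleHarmonicSum m (fun _ : Fin r => 2) := by
  simp only [multipleHarmonicSum, mul_sum]
  rw [sum_sigma']
  symm
  refine sum_bij' (fun x _ => Fin.snoc (α := fun _ => ℕ) x.2 x.1)
    (fun j _ => ⟨j (Fin.last r), Fin.init j⟩) ?_ ?_ ?_ ?_ ?_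
  · rintro ⟨m, j⟩ h
    simp only [mem_sigma, mem_filter, Fintype.mem_piFinset, mem_Icc] at h ⊢
    obtain ⟨hm, hj, hmono⟩ := h
    refine ⟨fun a => ?_, fun a b hab => ?_⟩
    · induction a using Fin.lastCases with
      | last => simpa using hm
      | cast a => simpa using ⟨(hj a).1, (hj a).2.trans hm.2⟩
    · induction b using Fin.lastCases with
      | last =>
        induction a using Fin.lastCases with
        | last => exact le_rfl
        | cast a => simpa using (hj a).2
      | cast b =>
        induction a using Fin.lastCases with
        | last => exact absurd hab (not_le.2 (Fin.castSucc_lt_last b))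
        | cast a => simpa using hmono a b (by simpa using hab)
  · intro j h
    simp only [mem_sigma, mem_filter, Fintype.mem_piFinset, mem_Icc] at h ⊢
    exact ⟨h.1 _, fun a => ⟨(h.1 _).1, h.2 _ _ (Fin.le_last _)⟩,
      fun a b hab => h.2 _ _ (by simpa using hab)⟩
  · rintro ⟨m, j⟩ _
    simp
  · intro j _
    simp
  · rintro ⟨m, j⟩ _
    rw [Fin.prod_univ_castSucc]
    simp [mul_comm]

theorem multipleHarmonicSum_two (r n : ℕ) :
    multipleHarmonicSum n (fun _ : Fin r => 2) = iteratedSum (fun k => 1 / (k : ℚ)) r n := by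
  induction r generalizing n with
  | zero => simp [multipleHarmonicSum, iteratedSum]
  | succ r ih =>
    rw [multipleHarmonicSum_two_succ, sum_Icc_one_eq_sum_range]
    simp only [ih, iteratedSum]

theorem pronicProd_quarter (n : ℕ) :
    pronicProd (fun k => 1 / (k : ℚ)) (1 / 4) n = ((2 * n).choose n : ℚ) ^ 2 / 16 ^ n := by
  induction n with
  | zero => simp [pronicProd]
  | succ n ih =>
    have h : ((n + 1 : ℕ) : ℚ) * (2 * (n + 1)).choose (n + 1)
        = 2 * (2 * n + 1) * (2 * n).choose n := by
      exact_mod_cast Nat.succ_mul_centralBinom_succ n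
    have h0 : ((n + 1 : ℕ) : ℚ) ≠ 0 := by positivity
    have e : pronicProd (fun k => 1 / (k : ℚ)) (1 / 4) (n + 1)
        = pronicProd (fun k => 1 / (k : ℚ)) (1 / 4) n
          * ((1 / ((n + 1 : ℕ) : ℚ)) ^ 2 * (1 / 4 + (n : ℚ) * ((n + 1 : ℕ) : ℚ))) :=
      prod_range_succ _ _
    rw [e, ih, eq_div_iff (by positivity)]
    refine mul_left_cancel₀ (pow_ne_zero 2 h0) ?_
    rw [← mul_pow, h]
    field_simp
    push_cast
    ring

theorem pronicSum_quarter (r n : ℕ) :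
    pronicSum (fun k => 1 / (k : ℚ)) r (1 / 4) n
      = ∑ k ∈ Icc 1 n, ((2 * k).choose k : ℚ) ^ 2 / ((k : ℚ) * 16 ^ k)
          * multipleHarmonicSum k (fun _ : Fin r => 2) := by
  rw [sum_Icc_one_eq_sum_range]
  refine sum_congr rfl fun k _ => ?_
  rw [pronicProd_quarter, multipleHarmonicSum_two, mul_comm (((k + 1 : ℕ) : ℚ)), ← div_div]
  ring

theorem pronicSum_congr {A : Type*} [CommRing A] {v w : ℕ → A} {n : ℕ}
    (h : ∀ k, 1 ≤ k → k ≤ n → v k = w k) (r : ℕ) (y : A) :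
    pronicSum v r y n = pronicSum w r y n := by
  refine sum_congr rfl fun k hk => ?_
  have hk := mem_range.1 hk
  rw [h _ (by omega) (by omega), iteratedSum_congr fun j h1 h2 => h j h1 (by omega)]
  congr 1
  refine prod_congr rfl fun j hj => ?_
  have hj := mem_range.1 hj
  rw [h _ (by omega) (by omega)]

/-! ### Lifting to the `p`-integral rationals, and the derivative at `1/4`. -/

section

variable {p : ℕ} [Fact p.Prime]

/-- The sequence of inverses of the natural numbers prime to `p`, with value `0` at the
multiples of `p`. -/
noncomputable def pIntegralInv (p : ℕ) [Fact p.Prime] (k : ℕ) : pIntegralSubring p :=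
  if hk : p ∣ k then 0 else ⟨1 / k, inv_natCast_mem_pIntegralSubring hk⟩

theorem coe_pIntegralInv {k : ℕ} (hk : 1 ≤ k) (hkp : k < p) :
    (pIntegralInv p k : ℚ) = 1 / k := by
  rw [pIntegralInv, dif_neg (Nat.not_dvd_of_pos_of_lt hk hkp)]

theorem natCast_mul_pIntegralInv {k : ℕ} (hk : 1 ≤ k) (hkp : k < p) :
    (k : pIntegralSubring p) * pIntegralInv p k = 1 := by
  ext
  push_cast
  rw [coe_pIntegralInv hk hkp]
  have : (k : ℚ) ≠ 0 := by positivity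
  field_simp

open Polynomial in
theorem exists_bernoulli_lift {m : ℕ} (hm : 1 ≤ m) (hmp : m + 1 < p) :
    ∃ s t : (pIntegralSubring p)[X],
      s.comp (X + 1) = s + X ^ m ∧ t.comp (X + 1) = t + X ^ (m - 1) ∧
      s.natDegree < p ∧ t.natDegree < p ∧ derivative s = (m : (pIntegralSubring p)[X]) * t ∧
      (derivative t).map (pIntegralSubring p).subtype = Polynomial.bernoulli (m - 1) := by
  have hinv : ∀ k : ℕ, 1 ≤ k → k < p → (1 / k : ℚ) ∈ pIntegralSubring p := fun k h1 h2 =>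
    inv_natCast_mem_pIntegralSubring (Nat.not_dvd_of_pos_of_lt h1 h2)
  have hm0 : (m : ℚ) ≠ 0 := by positivity
  have hm1 : ((m + 1 : ℕ) : ℚ) ≠ 0 := by positivity
  have hinj : Function.Injective (Polynomial.map (pIntegralSubring p).subtype) :=
    map_injective _ Subtype.val_injective
  obtain ⟨s, hs⟩ := exists_map_subtype_eq (R := pIntegralSubring p)
    -- The constant term is removed because `m + 1` may be `p - 1`, and `B_{p-1}` is not
    -- `p`-integral.
    (f := C (1 / ((m + 1 : ℕ) : ℚ)) * (Polynomial.bernoulli (m + 1) - C (_root_.bernoulli (m + 1))))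
    (fun i => by
      rw [coeff_C_mul, coeff_sub, coeff_C, coeff_bernoulli]
      refine mul_mem (hinv _ (by omega) hmp) ?_
      rcases Nat.eq_zero_or_pos i with rfl | hi
      · simp
      · rw [if_neg hi.ne', sub_zero]
        split_ifs
        · exact mul_mem (bernoulli_mem_pIntegralSubring (by omega)) (natCast_mem _ _)
        · exact zero_mem _)
  obtain ⟨t, ht⟩ := exists_map_subtype_eq (R := pIntegralSubring p)
    (f := C (1 / (m : ℚ)) * Polynomial.bernoulli m)
    (fun i => by
      rw [coeff_C_mul, coeff_bernoulli]
      refine mul_mem (hinv _ hm (by omega)) ?_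
      split_ifs
      · exact mul_mem (bernoulli_mem_pIntegralSubring (by omega)) (natCast_mem _ _)
      · exact zero_mem _)
  have e0 : (C (1 / (m : ℚ)) * (m : ℚ[X])) = 1 := by
    rw [← C_eq_natCast, ← C_mul, one_div_mul_cancel hm0, C_1]
  have e1 : (C (1 / ((m + 1 : ℕ) : ℚ)) * ((m + 1 : ℕ) : ℚ[X])) = 1 := by
    rw [← C_eq_natCast, ← C_mul, one_div_mul_cancel hm1, C_1]
  have hbd : ∀ n, (Polynomial.bernoulli n).natDegree ≤ n := fun n =>
    natDegree_le_iff_coeff_eq_zero.2 fun i hi => by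
      rw [coeff_bernoulli, if_neg (by omega)]
  refine ⟨s, t, hinj ?_, hinj ?_, ?_, ?_, hinj ?_, ?_⟩
  · simp only [Polynomial.map_comp, Polynomial.map_add, Polynomial.map_pow, map_X,
      Polynomial.map_one, hs, mul_comp, sub_comp, C_comp, bernoulli_comp_X_add_one,
      nsmul_eq_mul, Nat.add_sub_cancel]
    linear_combination X ^ m * e1
  · simp only [Polynomial.map_comp, Polynomial.map_add, Polynomial.map_pow, map_X,
      Polynomial.map_one, ht, mul_comp, C_comp, bernoulli_comp_X_add_one, nsmul_eq_mul]
    linear_combination X ^ (m - 1) * e0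
  · rw [← natDegree_map_eq_of_injective (f := (pIntegralSubring p).subtype)
      Subtype.val_injective, hs]
    refine (natDegree_C_mul_le _ _).trans_lt ((natDegree_sub_C).trans_lt ?_)
    have := hbd (m + 1)
    omega
  · rw [← natDegree_map_eq_of_injective (f := (pIntegralSubring p).subtype)
      Subtype.val_injective, ht]
    refine (natDegree_C_mul_le _ _).trans_lt ?_
    have := hbd m
    omega
  · rw [← derivative_map, Polynomial.map_mul, Polynomial.map_natCast, hs, ht]
    simp only [derivative_mul, derivative_C, derivative_sub, derivative_bernoulli_add_one]
    push_cast at e1 ⊢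
    linear_combination Polynomial.bernoulli m * (e1 - e0)
  · rw [← derivative_map, ht, derivative_C_mul, derivative_bernoulli]
    linear_combination Polynomial.bernoulli (m - 1) * e0

open Polynomial in
theorem pIntegralReduction_eval_derivative {r : ℕ} (hpr : 2 * r + 3 < p)
    {c b : pIntegralSubring p} (hc : 2 * c = 1) (hb : (b : ℚ) = _root_.bernoulli (p - 2 * r - 3)) :
    pIntegralReduction p ((derivative
        (pronicSum (fun k => C (pIntegralInv p k)) r X (p - 1))).eval (c ^ 2))
      = -2 * r * (2 ^ (2 * r + 3) - 1) * pIntegralReduction p b := by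
  set φ := pIntegralReduction p
  obtain ⟨s, t, hs, ht, hsd, htd, hst, htb⟩ := exists_bernoulli_lift (p := p)
    (m := p - 2 - 2 * r) (by omega) (by omega)
  have hm1 : p - 2 - 2 * r - 1 = p - 3 - 2 * r := by omega
  rw [hm1] at ht htb
  have hmap (f : (pIntegralSubring p)[X]) : (f.map φ).comp (X + 1) = (f.comp (X + 1)).map φ := by
    simp [Polynomial.map_comp]
  have hcφ : 2 * φ c = 1 := by
    simpa only [map_mul, map_ofNat, map_one] using congrArg φ hc
  have key := ZMod.eval_derivative_pronicSum (v := fun k => φ (pIntegralInv p k))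
    (fun k h1 h2 => by
      have := congrArg φ (natCast_mul_pIntegralInv (p := p) h1 (by omega))
      simpa using this) hpr (s := s.map φ) (t := t.map φ)
    (by rw [hmap, hs]; simp) (by rw [hmap, ht]; simp)
    (natDegree_map_le.trans_lt hsd) (natDegree_map_le.trans_lt htd)
    (by rw [derivative_map, hst]; simp) hcφ
  have e1 : (pronicSum (fun k => C (pIntegralInv p k)) r X (p - 1)).map φ
      = pronicSum (fun k => C (φ (pIntegralInv p k))) r X (p - 1) := by
    have := map_pronicSum (mapRingHom φ) (fun k => C (pIntegralInv p k)) r (p - 1) X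
    simpa using this
  rw [← e1, derivative_map, derivative_map, ← map_pow, eval_map_apply, eval_map_apply] at key
  rw [key]
  have hcq : (c : ℚ) = 1 / 2 := by
    have : 2 * (c : ℚ) = 1 := congrArg Subtype.val hc
    linarith
  have h3 : 2 ^ (p - 3 - 2 * r) * (derivative t).eval c = (2 - 2 ^ (p - 3 - 2 * r)) * b := by
    have h := two_pow_mul_bernoulli_eval_half (p - 3 - 2 * r)
    rw [← htb, ← hcq, show p - 3 - 2 * r = p - 2 * r - 3 by omega, ← hb] at h
    have e : ((derivative t).map (pIntegralSubring p).subtype).eval (c : ℚ)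
        = ((derivative t).eval c : pIntegralSubring p) :=
      eval_map_apply (f := (pIntegralSubring p).subtype) c
    rw [e] at h
    rw [show p - 3 - 2 * r = p - 2 * r - 3 by omega]
    ext
    push_cast
    exact h
  have h4 := congrArg φ h3
  simp only [map_mul, map_sub, map_pow, map_ofNat] at h4
  have h2 : (2 : ZMod p) ≠ 0 := fun h => by simp [h] at hcφ
  -- Fermat's little theorem turns the power of `2` from the half-argument formula into one
  -- depending only on `r`.
  have h5 : (2 : ZMod p) ^ (p - 3 - 2 * r) * 2 ^ (2 * r + 2) = 1 := by
    rw [← pow_add, show p - 3 - 2 * r + (2 * r + 2) = p - 1 by omega]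
    exact ZMod.pow_card_sub_one_eq_one h2
  have h6 : φ ((derivative t).eval c) = (2 ^ (2 * r + 3) - 1) * φ b := by
    rw [pow_succ _ (2 * r + 2)]
    linear_combination 2 ^ (2 * r + 2) * h4 - (φ ((derivative t).eval c) + φ b) * h5
  rw [h6]
  ring

end

/-! ### Taylor expansion at `1/4`. -/

theorem mainTheorem2 (p r : ℕ) (hp : p.Prime) (hpr : 2 * r + 3 < p) :
    PIntegralModEq p 3
      (∑ k ∈ Finset.Icc 1 (p - 1),
        ((2 * k).choose k : ℚ) ^ 2 / ((k : ℚ) * 16 ^ k)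
          * multipleHarmonicSum k (fun _ : Fin r => 2))
      (-2 * harmonicOfOrder (2 * r + 1) ((p - 1) / 2)
        - (r : ℚ) * (2 ^ (2 * r + 3) - 1) / 2 * (p : ℚ) ^ 2 * bernoulli (p - 2 * r - 3)) := by
  have : Fact p.Prime := ⟨hp⟩
  have hodd : 2 * ((p - 1) / 2) + 1 = p := by
    have := Nat.odd_iff.1 (hp.odd_of_ne_two (by omega))
    omega
  set R := pIntegralSubring p with hR
  set n := (p - 1) / 2 with hn
  let c : R := ⟨1 / (2 : ℕ), inv_natCast_mem_pIntegralSubring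
    (Nat.not_dvd_of_pos_of_lt (by omega) (by omega))⟩
  have hcq : (c : ℚ) = 1 / 2 := by simp [c]
  have hc : 2 * c = 1 := by
    refine Subtype.ext ?_
    change 2 * (c : ℚ) = 1
    rw [hcq]
    norm_num
  let b : R := ⟨bernoulli (p - 2 * r - 3), bernoulli_mem_pIntegralSubring (by omega)⟩
  have hder := pIntegralReduction_eval_derivative hpr hc (b := b) rfl
  set h : Polynomial R :=
    pronicSum (fun k => Polynomial.C (pIntegralInv p k)) r Polynomial.X (p - 1)
  have heval (y : R) : h.eval y = pronicSum (pIntegralInv p) r y (p - 1) := by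
    have := map_pronicSum (Polynomial.evalRingHom y)
      (fun k => Polynomial.C (pIntegralInv p k)) r (p - 1) Polynomial.X
    simpa using this
  have hL : ∑ k ∈ Finset.Icc 1 (p - 1), ((2 * k).choose k : ℚ) ^ 2 / ((k : ℚ) * 16 ^ k)
          * multipleHarmonicSum k (fun _ : Fin r => 2) = ((h.eval (c ^ 2) : R) : ℚ) := by
    have e := map_pronicSum R.subtype (pIntegralInv p) r (p - 1) (c ^ 2)
    rw [heval, ← pronicSum_quarter]
    refine Eq.trans ?_ e.symm
    have e2 : R.subtype (c ^ 2) = 1 / 4 := by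
      rw [map_pow, Subring.subtype_apply, hcq]
      norm_num
    rw [e2]
    exact pronicSum_congr (fun k h1 h2 => (coe_pIntegralInv h1 (by omega)).symm) r _
  have hH : -2 * harmonicOfOrder (2 * r + 1) n = ((h.eval (-n - (n : R) ^ 2) : R) : ℚ) := by
    rw [heval, pronicSum_neg_pronic (fun k h1 h2 => natCast_mul_pIntegralInv h1 (by omega)) r
      (by omega), harmonicOfOrder, sum_Icc_one_eq_sum_range]
    push_cast
    congr 1
    refine sum_congr rfl fun k hk => ?_
    have hk := mem_range.1 hk
    rw [coe_pIntegralInv (by omega) (by omega), div_pow, one_pow]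
    push_cast
    rfl
  obtain ⟨k, hk⟩ := Polynomial.binomExpansion h (c ^ 2) (-(c * p) ^ 2)
  have harg : c ^ 2 + -(c * p) ^ 2 = -n - (n : R) ^ 2 := by
    have : (p : R) = 2 * n + 1 := by exact_mod_cast hodd.symm
    rw [this]
    linear_combination (-(2 * c + 1) * n ^ 2 - 2 * c * n - n) * hc
  rw [harg] at hk
  -- This is the coefficient of `p²` in the difference of the two sides; its vanishing mod `p`
  -- supplies the third factor `p`.
  have hred : pIntegralReduction p (c ^ 2 * h.derivative.eval (c ^ 2) - k * c ^ 4 * p ^ 2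
      + r * (2 ^ (2 * r + 3) - 1) * c * b) = 0 := by
    have hcφ := congrArg (pIntegralReduction p) hc
    simp only [map_mul, map_ofNat, map_one] at hcφ
    simp only [map_add, map_sub, map_mul, map_pow, hder, map_natCast, map_ofNat, map_one,
      CharP.cast_eq_zero]
    linear_combination (-r * (2 ^ (2 * r + 3) - 1) * pIntegralReduction p c
      * pIntegralReduction p b) * hcφ
  obtain ⟨d, hd⟩ := exists_eq_mul_of_pIntegralReduction_eq_zero hred
  have hB : -2 * harmonicOfOrder (2 * r + 1) n
        - (r : ℚ) * (2 ^ (2 * r + 3) - 1) / 2 * (p : ℚ) ^ 2 * bernoulli (p - 2 * r - 3)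
      = ((h.eval (-n - (n : R) ^ 2) - r * (2 ^ (2 * r + 3) - 1) * c * p ^ 2 * b : R) : ℚ) := by
    have h2 : ((2 : R) : ℚ) = 2 := rfl
    have hb : (b : ℚ) = bernoulli (p - 2 * r - 3) := rfl
    rw [hH]
    push_cast
    rw [hcq, h2, hb]
    ring
  rw [hB, hL]
  refine ⟨(h.eval (c ^ 2)).2, Subtype.property _, d, d.2, ?_⟩
  have key : h.eval (c ^ 2)
      - (h.eval (-n - (n : R) ^ 2) - r * (2 ^ (2 * r + 3) - 1) * c * p ^ 2 * b) = p ^ 3 * d := by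
    rw [hk]
    linear_combination (p : R) ^ 2 * hd
  exact_mod_cast congrArg Subtype.val key
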